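/- Let $d,n\ge 1$. For a compact convex subset $B$ of a finite-dimensional real vector space let $\partial B=B\setminus ri(B)$, where $ri(B)$ is the interior of $B$ relative to its affine hull, and define the boundariness of $y\in B$ in $B$ as $$b_B(y)=1-\sup\ \max_j\pi_j ,$$ where the supremum is taken over all finite convex decompositions $y=\sum_j\pi_jx_j$ ($\pi_j\ge 0$, $\sum_j\pi_j=1$) with all $x_j\in\partial B$; it is understood to be $0$ if there is no such decomposition, which happens only if $B$ is a single point. Let $\mathcal H_d=\mathbb C^d$. The maximal value of boundariness for quantum convex sets is as follows. 1. States. For the set of density operators on $\mathcal H_d$ (positive operators of unit trace), the maximal value of boundariness is $1/d$, and it is attained at, and only at, the completely mixed state $\frac1d I$. 2. Observables. For the set of $n$-outcome observables on $\mathcal H_d$ ($n$-tuples $(E_1,\dots,E_n)$ of operators with $0\le E_j\le I$ and $\sum_jE_j=I$), the maximal value of boundariness is $1/n$, and it is attained at, and only at, the uniformly trivial observable $E_j=\frac1n I$, $j=1,\dots,n$. 3. Channels. For the set of completely positive trace-preserving linear maps from operators on $\mathcal H_d$ to operators on $\mathcal H_d$, the maximal value of boundariness is $1/d^2$, and it is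 attained at, and only at, the completely depolarizing channel $X\mapsto \mathrm{tr}(X)\,\frac1d I$. -/

import Mathlib

open scoped ComplexOrder

/-- The relative boundary `∂B = B \ ri(B)` of a subset `B` of a real topological vector space:
`ri(B)` is the interior of `B` relative to the affine hull of `B`. -/
def relBoundary {V : Type*} [AddCommGroup V] [Module ℝ V] [TopologicalSpace V]
    (B : Set V) : Set V :=
  B \ intrinsicInterior ℝ B

/-- The maximal weights `max_j π_j` of the finite convex decompositions `y = ∑_j π_j x_j`
of `y` into elements `x_j` of the relative boundary of `B`. -/
def boundaryWeights {V : Type*} [AddCommGroup V] [Module ℝ V] [TopologicalSpace V]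
    (B : Set V) (y : V) : Set ℝ :=
  {w | ∃ (k : ℕ) (π : Fin k → ℝ) (x : Fin k → V),
    (∀ j, 0 ≤ π j) ∧ ∑ j, π j = 1 ∧ (∀ j, x j ∈ relBoundary B) ∧ y = ∑ j, π j • x j ∧
    IsGreatest (Set.range π) w}

/-- The boundariness of `y` in `B`: one minus the supremum of the maximal weights of the
convex decompositions of `y` into boundary elements. (A one-point set has no boundary elements;
the supremum is then `0`, and the boundariness of the point is `1`.) -/
noncomputable def boundariness {V : Type*} [AddCommGroup V] [Module ℝ V] [TopologicalSpace V]
    (B : Set V) (y : V) : ℝ :=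
  1 - sSup (boundaryWeights B y)

/-- Operators on the `d`-dimensional Hilbert space `ℂ^d`. -/
abbrev Op (d : ℕ) : Type := Matrix (Fin d) (Fin d) ℂ

/-- Density operators: positive operators of unit trace. -/
def quantumStates (d : ℕ) : Set (Op d) :=
  {ρ | ρ.PosSemidef ∧ ρ.trace = 1}

/-- Observables with `n` outcomes: collections of effects `0 ≤ E_j ≤ I` with `∑_j E_j = I`. -/
def quantumObservables (d n : ℕ) : Set (Fin n → Op d) :=
  {E | (∀ j, (E j).PosSemidef ∧ (1 - E j).PosSemidef) ∧ ∑ j, E j = 1}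

/-- The map `id_k ⊗ Φ` on operators on `ℂ^k ⊗ ℂ^d`: apply `Φ` to each `d × d` block. -/
noncomputable def ampliation {d : ℕ} (k : ℕ) (Φ : Op d →L[ℂ] Op d)
    (X : Matrix (Fin k × Fin d) (Fin k × Fin d) ℂ) :
    Matrix (Fin k × Fin d) (Fin k × Fin d) ℂ :=
  Matrix.of fun p q => Φ (Matrix.of fun i j => X (p.1, i) (q.1, j)) p.2 q.2

/-- Quantum channels: completely positive trace-preserving linear maps. Linear maps between these
finite-dimensional spaces are automatically continuous; the type of continuous linear maps is used
because it carries the (unique) vector space topology. -/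
def quantumChannels (d : ℕ) : Set (Op d →L[ℂ] Op d) :=
  {Φ | (∀ (k : ℕ) (X : Matrix (Fin k × Fin d) (Fin k × Fin d) ℂ),
        X.PosSemidef → (ampliation k Φ X).PosSemidef) ∧
      ∀ X : Op d, (Φ X).trace = X.trace}

/-- The completely mixed state `I / d`. -/
noncomputable def completelyMixedState (d : ℕ) : Op d :=
  (d : ℂ)⁻¹ • (1 : Op d)

/-- The uniformly trivial observable `E_j = I / n` for all `j`. -/
noncomputable def uniformTrivialObservable (d n : ℕ) : Fin n → Op d :=
  fun _ => (n : ℂ)⁻¹ • (1 : Op d)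

/-- The completely depolarizing channel `X ↦ tr(X) I / d`. -/
noncomputable def completelyDepolarizingChannel (d : ℕ) : Op d →L[ℂ] Op d :=
  LinearMap.toContinuousLinearMap
    ((Matrix.traceLinearMap (Fin d) ℂ ℂ).smulRight (completelyMixedState d))

/-! Each of the three sets is an affine subspace cut by a compact family of linear inequalities `0 ≤
f i x`: quadratic forms at unit vectors of the state, of each effect, or of the Choi matrix. By
compactness some `f i` vanishes at every relative boundary point; conversely, a point of the set
where `f i` vanishes is a boundary point if `f i` is positive somewhere on the set.

Let `e` be the claimed maximizer and `N` the claimed reciprocal value. Every `f i` is at most `N * f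
i e` on the set. If `e = ∑ π j • x j` with boundary points `x j`, choose `i` with `f i (x j) = 0`;
then `f i e ≤ (1 - π j) * N * f i e`, so `π j ≤ 1 - 1 / N`. Equality is reached with points `p a`,
`N` in number and of barycenter `e`, each attaining the bound for some `i`: subtracting `(1 / N) • p
a` from `e` leaves a multiple of a boundary point.

For another point `y`, if `f i (p a) > N * f i y` for some `a` and `i`, the largest multiple of `p
a` that can be removed from `y` is below `1 / N`, and the remainder gives a weight above `1 - 1 / N`
(`exists_boundaryWeights_gt`). So it remains to show that only `e` dominates all `p a / N`. For
observables, `E j ≥ I / n` for all `j` and `∑ E j = I` force equality. For states and channels, the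
`p a` are rank-one matrices `u uᴴ` summing to `c • 1`; domination gives `uᴴ M⁻¹ u ≤ N`, hence `c *
tr M⁻¹ ≤ N ^ 2`, and with `tr M = c` this is the equality case of Cauchy–Schwarz
(`eq_smul_one_of_vecMulVec_le`). For channels the `p a` are conjugations by the `d ^ 2` Weyl
unitaries. -/

/-- The part of an affine subspace cut out by a family of linear inequalities. -/
def affineCone {V I : Type*} [AddCommGroup V] [Module ℝ V]
    (A : AffineSubspace ℝ V) (f : I → V →ₗ[ℝ] ℝ) : Set V :=
  {x | x ∈ A ∧ ∀ i, 0 ≤ f i x}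

/-! ### Boundary decompositions in a general convex set. -/

section BoundarinessGeneral

variable {V : Type*} [AddCommGroup V] [Module ℝ V] [TopologicalSpace V]

theorem weight_le_one_of_mem_boundaryWeights {B : Set V} {y : V} {w : ℝ}
    (hw : w ∈ boundaryWeights B y) : w ≤ 1 := by
  obtain ⟨k, π, x, h0, h1, -, -, ⟨j, rfl⟩, -⟩ := hw
  rw [← h1]
  exact Finset.single_le_sum (fun i _ => h0 i) (Finset.mem_univ j)

theorem bddAbove_boundaryWeights (B : Set V) (y : V) : BddAbove (boundaryWeights B y) :=
  ⟨1, fun _ hw => weight_le_one_of_mem_boundaryWeights hw⟩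

theorem boundariness_le_of_mem_boundaryWeights {B : Set V} {y : V} {w : ℝ}
    (hw : w ∈ boundaryWeights B y) : boundariness B y ≤ 1 - w :=
  sub_le_sub_left (le_csSup (bddAbove_boundaryWeights B y) hw) 1

theorem one_mem_boundaryWeights {B : Set V} {y : V} (hy : y ∈ relBoundary B) :
    1 ∈ boundaryWeights B y :=
  ⟨1, fun _ => 1, fun _ => y, by simp, by simp, by simp [hy], by simp, by simp [IsGreatest]⟩

/-- The bound `s ≤ 1 / 2` ensures that `1 - s` is the larger of the two weights. -/
theorem mem_boundaryWeights_of_two_points {B : Set V} {x z : V} {s : ℝ} (hs : 0 ≤ s)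
    (hs2 : s ≤ 1 / 2) (hx : x ∈ relBoundary B) (hz : z ∈ relBoundary B) :
    1 - s ∈ boundaryWeights B (s • x + (1 - s) • z) := by
  refine ⟨2, ![s, 1 - s], ![x, z], ?_, by simp, ?_, by simp [Fin.sum_univ_two], ?_⟩
  · intro j
    fin_cases j
    · simpa using hs
    · simp
      linarith
  · intro j
    fin_cases j
    · simpa using hx
    · simpa using hz
  · refine ⟨⟨1, by simp⟩, ?_⟩
    rintro _ ⟨j, rfl⟩
    fin_cases j
    · simp
      linarith
    · simp

variable [IsTopologicalAddGroup V] [ContinuousSMul ℝ V]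

/-- A point of the relative interior can be moved away from any other point inside the set. -/
theorem exists_pos_extension_of_mem_intrinsicInterior {B : Set V} {x y : V}
    (hx : x ∈ intrinsicInterior ℝ B) (hy : y ∈ B) : ∃ ε : ℝ, 0 < ε ∧ x + ε • (x - y) ∈ B := by
  obtain ⟨x', hx', rfl⟩ := mem_intrinsicInterior.1 hx
  have hyS : y ∈ affineSpan ℝ B := subset_affineSpan ℝ B hy
  have hmem : ∀ t : ℝ, (x' : V) + t • ((x' : V) - y) ∈ affineSpan ℝ B := fun t => by
    have := (affineSpan ℝ B).smul_vsub_vadd_mem t x'.2 hyS x'.2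
    simpa [add_comm] using this
  let g : ℝ → affineSpan ℝ B := fun t => ⟨(x' : V) + t • ((x' : V) - y), hmem t⟩
  have hg : Continuous g := by
    apply Continuous.subtype_mk
    fun_prop
  have hg0 : g 0 = x' := by
    apply Subtype.ext
    simp [g]
  have hnear : ∀ᶠ t in nhds (0 : ℝ), g t ∈ interior ((↑) ⁻¹' B : Set (affineSpan ℝ B)) :=
    hg.continuousAt.eventually_mem (by rw [hg0]; exact isOpen_interior.mem_nhds hx')
  obtain ⟨δ, hδ, hball⟩ := Metric.eventually_nhds_iff.1 hnear
  refine ⟨δ / 2, by positivity, ?_⟩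
  have hlt : dist (δ / 2) 0 < δ := by
    rw [Real.dist_eq, sub_zero, abs_of_pos (by positivity)]
    linarith
  have hin : g (δ / 2) ∈ ((↑) ⁻¹' B : Set (affineSpan ℝ B)) := interior_subset (hball hlt)
  exact hin

end BoundarinessGeneral

/-! ### Boundariness in sets cut out by a compact family of linear inequalities. -/

section AffineCone

variable {V I : Type*} [AddCommGroup V] [Module ℝ V] {A : AffineSubspace ℝ V}
  {f : I → V →ₗ[ℝ] ℝ}

theorem AffineSubspace.add_smul_sub_mem {x y z : V} (t : ℝ) (hx : x ∈ A) (hy : y ∈ A)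
    (hz : z ∈ A) : z + t • (x - y) ∈ A := by
  have := A.smul_vsub_vadd_mem t hx hy hz
  simpa [add_comm] using this

/-- Provides the partner `z` in `y = s • x + (1 - s) • z`. -/
theorem affineCone_residual_mem {x y : V} {s : ℝ} (hs : s < 1) (hx : x ∈ A) (hy : y ∈ A)
    (hle : ∀ i, s * f i x ≤ f i y) : (1 - s)⁻¹ • (y - s • x) ∈ affineCone A f := by
  have h1 : 0 < 1 - s := sub_pos.2 hs
  refine ⟨?_, fun i => ?_⟩
  · have := AffineSubspace.add_smul_sub_mem (s * (1 - s)⁻¹) hy hx hy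
    convert this using 1
    have h2 : (1 - s)⁻¹ = 1 + s * (1 - s)⁻¹ := by
      field_simp
      ring
    rw [smul_sub, smul_smul, smul_sub, mul_comm (1 - s)⁻¹ s]
    nth_rewrite 1 [h2]
    rw [add_smul, one_smul]
    abel
  · rw [map_smul, map_sub, map_smul, smul_eq_mul, smul_eq_mul]
    exact mul_nonneg (inv_nonneg.2 h1.le) (sub_nonneg.2 (hle i))

variable [TopologicalSpace V]

/-- If all `f i` are positive at `x`, compactness of `I` makes them simultaneously positive on a
neighbourhood, so `x` is a relative interior point. -/
theorem exists_eq_zero_of_mem_relBoundary_affineCone [TopologicalSpace I]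
    [CompactSpace I] (hf : Continuous fun z : I × V => f z.1 z.2) {x : V}
    (hx : x ∈ relBoundary (affineCone A f)) : ∃ i, f i x = 0 := by
  by_contra! hne
  obtain ⟨hxB, hnot⟩ := hx
  apply hnot
  have hpos : ∀ i, 0 < f i x := fun i => lt_of_le_of_ne (hxB.2 i) (hne i).symm
  have hspan : affineSpan ℝ (affineCone A f) ≤ A := affineSpan_le.2 fun z hz => hz.1
  refine mem_intrinsicInterior.2 ⟨⟨x, subset_affineSpan ℝ _ hxB⟩, ?_, rfl⟩
  rw [mem_interior_iff_mem_nhds]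
  have hev : ∀ᶠ z in nhds x, ∀ i ∈ (Set.univ : Set I), 0 < f i z := by
    refine isCompact_univ.eventually_forall_of_forall_eventually fun i _ => ?_
    have hc : Continuous fun z : V × I => f z.2 z.1 := hf.comp continuous_swap
    exact hc.continuousAt.eventually (lt_mem_nhds (hpos i))
  have hcont : ContinuousAt (Subtype.val : affineSpan ℝ (affineCone A f) → V)
      ⟨x, subset_affineSpan ℝ _ hxB⟩ := continuous_subtype_val.continuousAt
  have hsub := hcont.eventually hev
  filter_upwards [hsub] with z hz
  exact ⟨hspan z.2, fun i => (hz i trivial).le⟩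

variable [IsTopologicalAddGroup V] [ContinuousSMul ℝ V]

/-- From a relative interior point one could move slightly away from `y`, which would make `f i`
negative. -/
theorem mem_relBoundary_affineCone {x y : V} {i : I} (hx : x ∈ affineCone A f)
    (hy : y ∈ affineCone A f) (hxi : f i x = 0) (hyi : 0 < f i y) :
    x ∈ relBoundary (affineCone A f) := by
  refine ⟨hx, fun hint => ?_⟩
  obtain ⟨ε, hε, hmem⟩ := exists_pos_extension_of_mem_intrinsicInterior hint hy
  have := hmem.2 i
  rw [map_add, map_smul, map_sub, hxi, smul_eq_mul] at this
  nlinarith [mul_pos hε hyi]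

variable [TopologicalSpace I] [CompactSpace I]

/-- At a point whose functionals are all at least `N⁻¹` times their maximum, every decomposition
into boundary points has weights at most `1 - N⁻¹`. -/
theorem boundaryWeights_affineCone_le (hf : Continuous fun z : I × V => f z.1 z.2) {e : V}
    {N w : ℝ} (hN : 0 < N) (hpos : ∀ i, 0 < f i e)
    (hmax : ∀ x ∈ affineCone A f, ∀ i, f i x ≤ N * f i e)
    (hw : w ∈ boundaryWeights (affineCone A f) e) : w ≤ 1 - 1 / N := by
  obtain ⟨k, π, x, h0, h1, hx, he, ⟨j, rfl⟩, -⟩ := hw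
  obtain ⟨i, hi⟩ := exists_eq_zero_of_mem_relBoundary_affineCone hf (hx j)
  have hsum : f i e = ∑ l, π l * f i (x l) := by
    conv_lhs => rw [he]
    simp
  -- The term `j` drops out because `f i (x j) = 0`; all others obey the maximum bound.
  have hle : ∑ l, π l * f i (x l) ≤ ∑ l ∈ Finset.univ.erase j, π l * (N * f i e) := by
    rw [← Finset.add_sum_erase _ _ (Finset.mem_univ j), hi, mul_zero, zero_add]
    exact Finset.sum_le_sum fun l _ => mul_le_mul_of_nonneg_left (hmax _ (hx l).1 i) (h0 l)
  rw [← Finset.sum_mul, ← hsum] at hle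
  have hrest : π j + ∑ l ∈ Finset.univ.erase j, π l = 1 := by
    rw [Finset.add_sum_erase _ _ (Finset.mem_univ j), h1]
  have hN1 : 1 ≤ (∑ l ∈ Finset.univ.erase j, π l) * N := by
    have := hpos i
    by_contra! hlt
    nlinarith
  have : 1 / N ≤ ∑ l ∈ Finset.univ.erase j, π l := (div_le_iff₀ hN).2 hN1
  linarith

/-- A boundary point `p` that some functional sees above `N` times `y` yields a decomposition of
`y` with a weight larger than `1 - N⁻¹`. -/
theorem exists_boundaryWeights_gt (hf : Continuous fun z : I × V => f z.1 z.2) {e y p : V} {N : ℝ}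
    (hN : 2 ≤ N) (he : e ∈ affineCone A f) (hpos : ∀ i, 0 < f i e) (hy : y ∈ affineCone A f) (hp : p ∈ relBoundary (affineCone A f))
    (hviol : ∃ i, N * f i y < f i p) :
    ∃ w ∈ boundaryWeights (affineCone A f) y, 1 - 1 / N < w := by
  have hNpos : 0 < N := by linarith
  by_cases hyb : y ∈ relBoundary (affineCone A f)
  · refine ⟨1, one_mem_boundaryWeights hyb, ?_⟩
    have : 0 < 1 / N := by positivity
    linarith
  obtain ⟨i₁, hi₁⟩ := hviol
  have hypos : ∀ i, 0 < f i y := fun i =>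
    lt_of_le_of_ne (hy.2 i) fun h => hyb (mem_relBoundary_affineCone hy he h.symm (hpos i))
  have hcont : ∀ v, Continuous fun i => f i v := fun v =>
    hf.comp (continuous_id.prodMk continuous_const)
  -- With `r` the maximal ratio `f i p / f i y`, the largest multiple of `p` that can be subtracted
  -- from `y` is `1 / r`, and the remainder vanishes at the maximizing index `i₀`.
  obtain ⟨i₀, -, hi₀⟩ := isCompact_univ.exists_isMaxOn (⟨i₁, trivial⟩ : (Set.univ : Set I).Nonempty)
    ((hcont p).div (hcont y) fun i => (hypos i).ne').continuousOn
  have hr : ∀ i, f i p / f i y ≤ f i₀ p / f i₀ y := fun i => hi₀ (Set.mem_univ i)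
  set r := f i₀ p / f i₀ y with hrdef
  have hNr : N < r := ((lt_div_iff₀ (hypos i₁)).2 hi₁).trans_le (hr i₁)
  have hrpos : 0 < r := hNpos.trans hNr
  have hs : 1 / r < 1 / N := one_div_lt_one_div_of_lt hNpos hNr
  have hN2 : 1 / N ≤ 1 / 2 := one_div_le_one_div_of_le two_pos hN
  have hs1 : 1 / r < 1 := by linarith
  have hle : ∀ i, 1 / r * f i p ≤ f i y := fun i => by
    have h := (div_le_iff₀ (hypos i)).1 (hr i)
    rw [one_div, inv_mul_le_iff₀ hrpos]
    exact h
  have hz := affineCone_residual_mem hs1 hp.1.1 hy.1 hle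
  have heq : f i₀ p = r * f i₀ y := by
    rw [hrdef, div_mul_cancel₀ _ (hypos i₀).ne']
  have hz0 : f i₀ ((1 - 1 / r)⁻¹ • (y - (1 / r) • p)) = 0 := by
    rw [map_smul, map_sub, map_smul, heq, smul_eq_mul, smul_eq_mul, ← mul_assoc,
      one_div_mul_cancel hrpos.ne', one_mul, sub_self, mul_zero]
  have hw := mem_boundaryWeights_of_two_points (one_div_pos.2 hrpos).le (by linarith) hp
    (mem_relBoundary_affineCone hz he hz0 (hpos i₀))
  rw [smul_inv_smul₀ (sub_pos.2 hs1).ne', add_sub_cancel] at hw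
  exact ⟨_, hw, by linarith⟩

/-- If the functionals at `e` are at least `N⁻¹` times their maximum over the set, and `e` is the
barycenter of `N` points reaching this maximum and is determined by them, then the maximal
boundariness is `N⁻¹`, attained exactly at `e`. -/
theorem boundariness_affineCone_max {ι : Type*} [Fintype ι] [Nonempty ι]
    (hf : Continuous fun z : I × V => f z.1 z.2) {B : Set V} (hB : B = affineCone A f)
    {e : V} {p : ι → V} (heA : e ∈ A) (hpos : ∀ i, 0 < f i e)
    (hmax : ∀ x ∈ B, ∀ i, f i x ≤ Fintype.card ι * f i e)
    (hp : ∀ a, p a ∈ B) (hsum : ∑ a, p a = (Fintype.card ι : ℝ) • e)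
    (hattain : ∀ a, ∃ i, f i (p a) = Fintype.card ι * f i e)
    (hrigid : ∀ y ∈ B, (∀ a i, f i (p a) ≤ Fintype.card ι * f i y) → y = e) :
    IsGreatest (boundariness B '' B) (1 / (Fintype.card ι : ℝ)) ∧
      {y ∈ B | boundariness B y = 1 / (Fintype.card ι : ℝ)} = {e} := by
  subst hB
  have heB : e ∈ affineCone A f := ⟨heA, fun i => (hpos i).le⟩
  suffices h : boundariness (affineCone A f) e = 1 / (Fintype.card ι : ℝ) ∧
      ∀ y ∈ affineCone A f, y ≠ e →
        boundariness (affineCone A f) y < 1 / (Fintype.card ι : ℝ) by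
    refine ⟨⟨⟨e, heB, h.1⟩, ?_⟩, ?_⟩
    · rintro _ ⟨y, hy, rfl⟩
      by_cases hye : y = e
      · rw [hye, h.1]
      · exact (h.2 y hy hye).le
    · ext y
      refine ⟨fun hy => ?_, ?_⟩
      · by_contra hye
        exact (h.2 y hy.1 hye).ne hy.2
      · rintro rfl
        exact ⟨heB, h.1⟩
  have hcard : 0 < (Fintype.card ι : ℝ) := by exact_mod_cast Fintype.card_pos
  -- For `N = 1` the weight `1 / N` exceeds `1 / 2`. Here the set is the single point `e`: there are
  -- no boundary points, and `sSup ∅ = 0` gives boundariness `1`.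
  rcases subsingleton_or_nontrivial ι with hι | hι
  · have hc1 : (Fintype.card ι : ℝ) = 1 := by
      exact_mod_cast le_antisymm (Fintype.card_le_one_iff_subsingleton.2 hι) Fintype.card_pos
    obtain ⟨a₀⟩ := ‹Nonempty ι›
    have hpe : ∀ a, p a = e := fun a => by
      rw [← one_smul ℝ e, ← hc1, ← hsum, Fintype.sum_subsingleton p a]
    have hall : ∀ y ∈ affineCone A f, y = e := fun y hy => by
      -- The maximum bound for `y` and for its reflection through `e` gives `f i y = f i e` from two
      -- inequalities.
      have hrefl : e + (1 : ℝ) • (e - y) ∈ affineCone A f := by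
        refine ⟨AffineSubspace.add_smul_sub_mem 1 heA hy.1 heA, fun i => ?_⟩
        have := hmax y hy i
        rw [hc1, one_mul] at this
        rw [one_smul, map_add, map_sub]
        linarith [hpos i]
      refine hrigid y hy fun a i => ?_
      have := hmax _ hrefl i
      rw [hc1, one_mul] at this
      rw [one_smul, map_add, map_sub] at this
      rw [hpe, hc1, one_mul]
      linarith
    refine ⟨?_, fun y hy hne => absurd (hall y hy) hne⟩
    have hsing : affineCone A f = {e} := Set.eq_singleton_iff_unique_mem.2 ⟨heB, hall⟩
    have hempty : boundaryWeights (affineCone A f) e = ∅ := by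
      refine Set.eq_empty_of_forall_notMem ?_
      rintro w ⟨k, π, x, -, -, hx, -, ⟨j, -⟩, -⟩
      have := hx j
      rw [hsing, relBoundary, intrinsicInterior_singleton, Set.sdiff_self] at this
      exact this
    rw [boundariness, hempty, Real.sSup_empty, hc1]
    norm_num
  have hN2 : 2 ≤ (Fintype.card ι : ℝ) := by
    exact_mod_cast (Fintype.one_lt_card : 1 < Fintype.card ι)
  -- At an index where another `p b` reaches the maximum `N * f i e`, that value already exhausts
  -- the sum over all `p c`, so `f i (p a) = 0`.
  have hpb : ∀ a, p a ∈ relBoundary (affineCone A f) := fun a => by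
    obtain ⟨b, hba⟩ := exists_ne a
    obtain ⟨i, hi⟩ := hattain b
    refine mem_relBoundary_affineCone (hp a) heB (i := i) ?_ (hpos i)
    have hs : ∑ c, f i (p c) = f i (p b) := by
      rw [← map_sum, hsum, map_smul, smul_eq_mul, hi]
    classical
    rw [← Finset.add_sum_erase _ _ (Finset.mem_univ b), add_eq_left,
      Finset.sum_eq_zero_iff_of_nonneg fun c _ => (hp c).2 i] at hs
    exact hs a (by simp [hba.symm])
  constructor
  · have hgreat : IsGreatest (boundaryWeights (affineCone A f) e)
        (1 - 1 / (Fintype.card ι : ℝ)) := by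
      refine ⟨?_, fun w hw => boundaryWeights_affineCone_le hf hcard hpos hmax hw⟩
      obtain ⟨a⟩ := ‹Nonempty ι›
      obtain ⟨i, hi⟩ := hattain a
      have hs2 : 1 / (Fintype.card ι : ℝ) ≤ 1 / 2 := one_div_le_one_div_of_le two_pos hN2
      have hs1 : 1 / (Fintype.card ι : ℝ) < 1 := by linarith
      have hz := affineCone_residual_mem hs1 (hp a).1 heA fun i => by
        rw [one_div, inv_mul_le_iff₀ hcard]
        exact hmax _ (hp a) i
      have hz0 : f i ((1 - 1 / (Fintype.card ι : ℝ))⁻¹ •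
          (e - (1 / (Fintype.card ι : ℝ)) • p a)) = 0 := by
        rw [map_smul, map_sub, map_smul, hi, smul_eq_mul, smul_eq_mul, ← mul_assoc,
          one_div_mul_cancel hcard.ne', one_mul, sub_self, mul_zero]
      have hw := mem_boundaryWeights_of_two_points (one_div_pos.2 hcard).le hs2 (hpb a)
        (mem_relBoundary_affineCone hz heB hz0 (hpos i))
      rwa [smul_inv_smul₀ (sub_pos.2 hs1).ne', add_sub_cancel] at hw
    rw [boundariness, hgreat.csSup_eq, sub_sub_cancel]
  · intro y hy hne
    have hviol : ∃ a i, Fintype.card ι * f i y < f i (p a) := by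
      by_contra! h
      exact hne (hrigid y hy h)
    obtain ⟨a, hviol⟩ := hviol
    obtain ⟨w, hw, hlt⟩ := exists_boundaryWeights_gt hf hN2 heB hpos hy (hpb a) hviol
    have := boundariness_le_of_mem_boundaryWeights hw
    linarith

end AffineCone

/-! ### Quadratic forms on the unit sphere and rigidity of the identity. -/

section QuadraticForm

open Matrix

variable {m ι : Type*} [Fintype m]

/-- The real part of the quadratic form `M ↦ ⟨u, M u⟩`, as a real-linear functional of `M`. -/
noncomputable def quadForm (u : m → ℂ) : Matrix m m ℂ →ₗ[ℝ] ℝ where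
  toFun M := (star u ⬝ᵥ M *ᵥ u).re
  map_add' M M' := by rw [add_mulVec, dotProduct_add, Complex.add_re]
  map_smul' r M := by
    rw [smul_mulVec, dotProduct_smul, Complex.real_smul, Complex.re_ofReal_mul, RingHom.id_apply,
      smul_eq_mul]

theorem quadForm_apply (u : m → ℂ) (M : Matrix m m ℂ) :
    quadForm u M = (star u ⬝ᵥ M *ᵥ u).re := rfl

theorem quadForm_smul_left (r : ℝ) (u : m → ℂ) (M : Matrix m m ℂ) :
    quadForm ((r : ℂ) • u) M = r ^ 2 * quadForm u M := by
  have hr : star (r : ℂ) = r := Complex.conj_ofReal r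
  rw [quadForm_apply, quadForm_apply, star_smul, mulVec_smul, smul_dotProduct, dotProduct_smul, hr,
    smul_eq_mul, smul_eq_mul, Complex.re_ofReal_mul, Complex.re_ofReal_mul]
  ring

theorem Matrix.PosSemidef.quadForm_nonneg {M : Matrix m m ℂ} (hM : M.PosSemidef) (u : m → ℂ) :
    0 ≤ quadForm u M :=
  hM.re_dotProduct_nonneg u

theorem Matrix.IsHermitian.coe_quadForm {M : Matrix m m ℂ} (hM : M.IsHermitian) (u : m → ℂ) :
    (quadForm u M : ℂ) = star u ⬝ᵥ M *ᵥ u := by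
  apply Complex.ext
  · simp [quadForm_apply]
  · rw [Complex.ofReal_im]
    exact (hM.im_star_dotProduct_mulVec_self u).symm

theorem quadForm_vecMulVec (w u : m → ℂ) :
    quadForm w (vecMulVec u (star u)) = Complex.normSq (star w ⬝ᵥ u) := by
  have h : star u ⬝ᵥ w = star (star w ⬝ᵥ u) := by
    rw [star_dotProduct]
  rw [quadForm_apply, vecMulVec_mulVec, dotProduct_smul, h]
  simp [Complex.normSq_apply]

theorem quadForm_smul_one [DecidableEq m] (u : m → ℂ) (r : ℝ) :
    quadForm u ((r : ℂ) • (1 : Matrix m m ℂ)) = r * (star u ⬝ᵥ u).re := by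
  rw [quadForm_apply, smul_mulVec, one_mulVec, dotProduct_smul, smul_eq_mul, Complex.re_ofReal_mul]

theorem star_dotProduct_self_eq_norm_sq (v : EuclideanSpace ℂ m) :
    star v.ofLp ⬝ᵥ v.ofLp = ((‖v‖ ^ 2 : ℝ) : ℂ) := by
  rw [dotProduct_comm, ← EuclideanSpace.inner_eq_star_dotProduct, inner_self_eq_norm_sq_to_K]
  simp

/-- The unit sphere of `ℂ^m`. -/
abbrev UnitSphere (m : Type*) [Fintype m] : Type _ := Metric.sphere (0 : EuclideanSpace ℂ m) 1

theorem UnitSphere.star_dotProduct_self (v : UnitSphere m) :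
    star v.1.ofLp ⬝ᵥ v.1.ofLp = 1 := by
  rw [star_dotProduct_self_eq_norm_sq, norm_eq_of_mem_sphere]
  simp

theorem UnitSphere.quadForm_smul_one [DecidableEq m] (v : UnitSphere m) (r : ℝ) :
    quadForm v.1.ofLp ((r : ℂ) • (1 : Matrix m m ℂ)) = r := by
  rw [_root_.quadForm_smul_one, v.star_dotProduct_self, Complex.one_re, mul_one]

theorem exists_eq_smul_unitSphere {u : m → ℂ} (hu : u ≠ 0) :
    ∃ (r : ℝ) (v : UnitSphere m), u = (r : ℂ) • v.1.ofLp ∧ star u ⬝ᵥ u = ((r ^ 2 : ℝ) : ℂ) := by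
  have hne : ‖WithLp.toLp 2 u‖ ≠ 0 := by
    rw [norm_ne_zero_iff]
    intro h
    exact hu (by simpa using congrArg WithLp.ofLp h)
  refine ⟨‖WithLp.toLp 2 u‖, ⟨((‖WithLp.toLp 2 u‖⁻¹ : ℝ) : ℂ) • WithLp.toLp 2 u, ?_⟩, ?_,
    star_dotProduct_self_eq_norm_sq (WithLp.toLp 2 u)⟩
  · rw [mem_sphere_zero_iff_norm, norm_smul, Complex.norm_real, norm_inv, norm_norm,
      inv_mul_cancel₀ hne]
  · rw [WithLp.ofLp_smul, smul_smul, ← Complex.ofReal_mul, mul_inv_cancel₀ hne, Complex.ofReal_one,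
      one_smul]

theorem quadForm_nonneg_of_unitSphere {M : Matrix m m ℂ}
    (h : ∀ v : UnitSphere m, 0 ≤ quadForm v.1.ofLp M) (u : m → ℂ) : 0 ≤ quadForm u M := by
  by_cases hu : u = 0
  · simp [hu, quadForm_apply]
  · obtain ⟨r, v, hv, -⟩ := exists_eq_smul_unitSphere hu
    rw [hv, quadForm_smul_left]
    exact mul_nonneg (sq_nonneg r) (h v)

theorem posSemidef_iff_quadForm_unitSphere {M : Matrix m m ℂ} :
    M.PosSemidef ↔ M.IsHermitian ∧ ∀ v : UnitSphere m, 0 ≤ quadForm v.1.ofLp M := by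
  refine ⟨fun h => ⟨h.1, fun v => h.quadForm_nonneg _⟩, fun h => ?_⟩
  refine PosSemidef.of_dotProduct_mulVec_nonneg h.1 fun u => ?_
  rw [← h.1.coe_quadForm]
  exact Complex.zero_le_real.2 (quadForm_nonneg_of_unitSphere h.2 u)

theorem Continuous.quadForm_unitSphere {X : Type*} [TopologicalSpace X] {v : X → UnitSphere m}
    {M : X → Matrix m m ℂ} (hv : Continuous v) (hM : Continuous M) :
    Continuous fun x => quadForm (v x).1.ofLp (M x) := by
  have hv' : Continuous fun x => (v x).1.ofLp :=
    (PiLp.continuous_ofLp 2 _).comp (continuous_subtype_val.comp hv)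
  exact Complex.continuous_re.comp (hv'.star.dotProduct (hM.matrix_mulVec hv'))

theorem quadForm_eq_re_trace (u : m → ℂ) (M : Matrix m m ℂ) :
    quadForm u M = (M * vecMulVec u (star u)).trace.re := by
  rw [quadForm_apply, mul_vecMulVec, trace_vecMulVec, dotProduct_comm]

/-- With `P` the projection onto `v`, the difference is the trace of the positive matrix `(1 - P) M
(1 - P)`. -/
theorem Matrix.PosSemidef.quadForm_unitSphere_le_trace {M : Matrix m m ℂ} (hM : M.PosSemidef)
    (v : UnitSphere m) : quadForm v.1.ofLp M ≤ M.trace.re := by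
  classical
  set P : Matrix m m ℂ := vecMulVec v.1.ofLp (star v.1.ofLp) with hP
  have hPP : P * P = P := by
    rw [hP, vecMulVec_mul_vecMulVec, v.star_dotProduct_self, one_smul]
  have hPH : (1 - P)ᴴ = 1 - P := by
    rw [conjTranspose_sub, conjTranspose_one, hP, conjTranspose_vecMulVec, star_star]
  have h := (hM.conjTranspose_mul_mul_same (1 - P)).trace_nonneg
  have hQQ : (1 - P) * (1 - P) = 1 - P := by
    rw [mul_sub, sub_mul, sub_mul, hPP]
    simp
  rw [hPH, trace_mul_cycle, hQQ, sub_mul, one_mul, trace_sub, trace_mul_comm] at h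
  have := (Complex.nonneg_iff.1 h).1
  rw [Complex.sub_re] at this
  rw [quadForm_eq_re_trace]
  linarith

theorem Matrix.IsHermitian.eq_zero_of_quadForm_unitSphere {M : Matrix m m ℂ} (hM : M.IsHermitian)
    (h : ∀ v : UnitSphere m, quadForm v.1.ofLp M = 0) : M = 0 := by
  classical
  have h1 : M.PosSemidef := posSemidef_iff_quadForm_unitSphere.2 ⟨hM, fun v => (h v).ge⟩
  have h2 : (-M).PosSemidef :=
    posSemidef_iff_quadForm_unitSphere.2 ⟨hM.neg, fun v => by rw [map_neg, h v, neg_zero]⟩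
  have h3 := h2.trace_nonneg
  rw [trace_neg, neg_nonneg] at h3
  exact h1.trace_eq_zero_iff.1 (le_antisymm h3 h1.trace_nonneg)

variable [Fintype ι]

/-- If `M` dominates `N⁻¹ u_a u_aᴴ` for `N` vectors with `∑ u_a u_aᴴ = c 1`, and `M` has trace `c`,
then `M` is the multiple `c N⁻¹` of the identity. -/
theorem eq_smul_one_of_vecMulVec_le [DecidableEq m] [Nonempty m] {M : Matrix m m ℂ}
    (hM : M.PosSemidef) {c : ℝ} (hc : 0 < c) (htr : M.trace = (c : ℂ)) {u : ι → m → ℂ}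
    (hcard : Fintype.card ι = Fintype.card m)
    (hu : ∑ a, vecMulVec (u a) (star (u a)) = (c : ℂ) • (1 : Matrix m m ℂ))
    (hle : ∀ a (v : UnitSphere m), quadForm v.1.ofLp (vecMulVec (u a) (star (u a))) ≤
      Fintype.card m * quadForm v.1.ofLp M) :
    M = ((c / Fintype.card m : ℝ) : ℂ) • (1 : Matrix m m ℂ) := by
  set N : ℝ := (Fintype.card m : ℝ) with hN
  have hNpos : 0 < N := by
    rw [hN]
    exact_mod_cast Fintype.card_pos
  have hle' : ∀ a w, Complex.normSq (star w ⬝ᵥ u a) ≤ N * quadForm w M := fun a w => by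
    have := quadForm_nonneg_of_unitSphere (M := N • M - vecMulVec (u a) (star (u a)))
      (fun v => by
        rw [map_sub, map_smul, smul_eq_mul]
        exact sub_nonneg.2 (hle a v)) w
    rw [map_sub, map_smul, smul_eq_mul, quadForm_vecMulVec] at this
    linarith
  have hpd : M.PosDef := by
    refine PosDef.of_dotProduct_mulVec_pos hM.1 fun w hw => ?_
    rw [← hM.1.coe_quadForm]
    refine Complex.zero_lt_real.2 ?_
    have h1 : ∑ a, Complex.normSq (star w ⬝ᵥ u a) = c * (star w ⬝ᵥ w).re := by
      rw [← quadForm_smul_one, ← hu, map_sum]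
      simp only [quadForm_vecMulVec]
    have h2 : ∑ a, Complex.normSq (star w ⬝ᵥ u a) ≤ ∑ _a : ι, N * quadForm w M :=
      Finset.sum_le_sum fun a _ => hle' a w
    have h3 : 0 < (star w ⬝ᵥ w).re :=
      (Complex.pos_iff.1 (dotProduct_star_self_pos_iff.2 hw)).1
    rw [h1, Finset.sum_const, Finset.card_univ, nsmul_eq_mul, hcard, ← hN, ← mul_assoc] at h2
    exact pos_of_mul_pos_right ((mul_pos hc h3).trans_le h2) (by positivity)
  have hdet : IsUnit M.det := (isUnit_iff_isUnit_det M).1 hpd.isUnit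
  have hinv := hpd.inv
  -- For the test vector `M⁻¹ u_a`, both sides are expressed by `q = u_aᴴ M⁻¹ u_a`, and domination
  -- reads `q ^ 2 ≤ N * q`.
  have hq : ∀ a, quadForm (u a) M⁻¹ ≤ N := fun a => by
    have h := hle' a (M⁻¹ *ᵥ u a)
    have h1 : star (M⁻¹ *ᵥ u a) ⬝ᵥ u a = (quadForm (u a) M⁻¹ : ℂ) := by
      rw [hinv.1.coe_quadForm, star_mulVec, hinv.1.eq, dotProduct_mulVec]
    have h2 : quadForm (M⁻¹ *ᵥ u a) M = quadForm (u a) M⁻¹ := by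
      rw [quadForm_apply, mulVec_mulVec, mul_nonsing_inv _ hdet, one_mulVec, h1, Complex.ofReal_re]
    rw [h1, h2, Complex.normSq_ofReal] at h
    by_contra! hlt
    nlinarith
  have hinvtr : c * M⁻¹.trace.re ≤ N * N := by
    have h1 : ∑ a, quadForm (u a) M⁻¹ = c * M⁻¹.trace.re := by
      simp only [quadForm_eq_re_trace]
      rw [← Complex.re_sum, ← trace_sum, ← Finset.mul_sum, hu, mul_smul_comm, mul_one, trace_smul,
        smul_eq_mul, Complex.re_ofReal_mul]
    rw [← h1]
    refine (Finset.sum_le_sum fun a _ => hq a).trans ?_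
    rw [Finset.sum_const, Finset.card_univ, nsmul_eq_mul, hcard]
  -- The goal is `t M = 1`. The positive matrix `(1 - tM) M⁻¹ (1 - tM)` has trace `tr M⁻¹ - 2tN +
  -- t²c`, at most zero for this `t`, so it vanishes.
  set t : ℝ := N / c with ht
  have htM : (1 - (t : ℂ) • M)ᴴ = 1 - (t : ℂ) • M := by
    rw [conjTranspose_sub, conjTranspose_one, conjTranspose_smul, hM.1.eq]
    simp
  have hpsd := hinv.posSemidef.conjTranspose_mul_mul_same (1 - (t : ℂ) • M)
  rw [htM] at hpsd
  have hexp : (1 - (t : ℂ) • M) * M⁻¹ * (1 - (t : ℂ) • M) =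
      M⁻¹ - ((2 * t : ℝ) : ℂ) • (1 : Matrix m m ℂ) + ((t ^ 2 : ℝ) : ℂ) • M := by
    rw [sub_mul, smul_mul_assoc, mul_nonsing_inv _ hdet, one_mul, mul_sub, mul_one, sub_mul,
      mul_smul_comm, nonsing_inv_mul _ hdet, smul_mul_assoc, one_mul, smul_smul]
    push_cast
    rw [two_mul, add_smul, sq]
    abel
  have htrace : ((1 - (t : ℂ) • M) * M⁻¹ * (1 - (t : ℂ) • M)).trace.re ≤ 0 := by
    rw [hexp, trace_add, trace_sub, trace_smul, trace_smul, trace_one, htr, smul_eq_mul,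
      smul_eq_mul, Complex.add_re, Complex.sub_re, Complex.re_ofReal_mul, Complex.re_ofReal_mul,
      Complex.ofReal_re, Complex.natCast_re, ← hN, ht]
    have h1 : M⁻¹.trace.re ≤ N * N / c := (le_div_iff₀ hc).2 (by linarith)
    have h2 : (N / c) ^ 2 * c = N * N / c := by
      field_simp
    have h3 : 2 * (N / c) * N = 2 * (N * N / c) := by
      ring
    linarith
  have hnn := Complex.nonneg_iff.1 hpsd.trace_nonneg
  have hzero := hpsd.trace_eq_zero_iff.1
    (Complex.ext (le_antisymm htrace hnn.1) hnn.2.symm)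
  have hsq : (1 - (t : ℂ) • M)ᴴ * (1 - (t : ℂ) • M) = 0 := by
    have h1 : M⁻¹ * (1 - (t : ℂ) • M) = (1 - (t : ℂ) • M) * M⁻¹ := by
      rw [mul_sub, sub_mul, mul_smul_comm, smul_mul_assoc, mul_nonsing_inv _ hdet,
        nonsing_inv_mul _ hdet, mul_one, one_mul]
    rw [mul_assoc, h1, ← mul_assoc] at hzero
    have h2 := congrArg (· * M) hzero
    simp only [mul_assoc, nonsing_inv_mul _ hdet, mul_one, zero_mul] at h2
    rw [htM, h2]
  have hfin := sub_eq_zero.1 (conjTranspose_mul_self_eq_zero.1 hsq)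
  have htne : (t : ℂ) ≠ 0 := by
    rw [ht]
    exact_mod_cast (div_pos hNpos hc).ne'
  rw [hfin, smul_smul, ← Complex.ofReal_mul, ht, div_mul_div_cancel₀ hNpos.ne', div_self hc.ne',
    Complex.ofReal_one, one_smul]

end QuadraticForm

/-! ### Positive matrices of fixed trace, and states. -/

section PosSemidefSets

open Matrix

/-- The maximal boundariness of a convex set that is identified, by an injective linear map, with
a set of positive semidefinite matrices of fixed trace containing the rank-one matrices of a
family of vectors resolving a multiple of the identity. -/
theorem boundariness_posSemidef_max {V m ι : Type*} [AddCommGroup V] [Module ℝ V]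
    [TopologicalSpace V] [IsTopologicalAddGroup V] [ContinuousSMul ℝ V] [Fintype m] [DecidableEq m]
    [Nonempty m] [Fintype ι] {A : AffineSubspace ℝ V} {C : V →ₗ[ℝ] Matrix m m ℂ}
    (hC : Continuous C) (hinj : Function.Injective C) {B : Set V}
    (hB : ∀ x, x ∈ B ↔ x ∈ A ∧ (C x).PosSemidef) (hherm : ∀ x ∈ A, (C x).IsHermitian) {c : ℝ}
    (hc : 0 < c) (htr : ∀ x ∈ A, (C x).trace = (c : ℂ)) {u : ι → m → ℂ}
    (hcard : Fintype.card ι = Fintype.card m)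
    (hu : ∑ a, vecMulVec (u a) (star (u a)) = (c : ℂ) • (1 : Matrix m m ℂ)) {p : ι → V}
    (hp : ∀ a, p a ∈ A) (hCp : ∀ a, C (p a) = vecMulVec (u a) (star (u a))) {e : V} (he : e ∈ A)
    (hCe : C e = ((c / Fintype.card m : ℝ) : ℂ) • (1 : Matrix m m ℂ)) :
    IsGreatest (boundariness B '' B) (1 / (Fintype.card m : ℝ)) ∧
      {y ∈ B | boundariness B y = 1 / (Fintype.card m : ℝ)} = {e} := by
  have hN : 0 < (Fintype.card m : ℝ) := by exact_mod_cast Fintype.card_pos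
  have : Nonempty ι := Fintype.card_pos_iff.1 (hcard ▸ Fintype.card_pos)
  have hqe : ∀ v : UnitSphere m, Fintype.card m * quadForm v.1.ofLp (C e) = c := fun v => by
    rw [hCe, v.quadForm_smul_one, mul_div_cancel₀ _ hN.ne']
  rw [← hcard] at hqe ⊢
  refine boundariness_affineCone_max (A := A) (p := p)
    (f := fun v : UnitSphere m => (quadForm v.1.ofLp).comp C) ?_ ?_ he ?_ ?_ ?_ ?_ ?_ ?_
  · exact continuous_fst.quadForm_unitSphere (hC.comp continuous_snd)
  · ext x
    rw [hB, posSemidef_iff_quadForm_unitSphere]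
    exact ⟨fun h => ⟨h.1, h.2.2⟩, fun h => ⟨h.1, hherm x h.1, h.2⟩⟩
  · intro v
    rw [← hcard] at hN
    refine pos_of_mul_pos_right (b := quadForm v.1.ofLp (C e)) ?_ hN.le
    rw [hqe]
    exact hc
  · intro x hx v
    obtain ⟨hxA, hxP⟩ := (hB x).1 hx
    have := hxP.quadForm_unitSphere_le_trace v
    rw [htr x hxA, Complex.ofReal_re] at this
    exact this.trans (hqe v).ge
  · intro a
    rw [hB, hCp]
    exact ⟨hp a, posSemidef_vecMulVec_self_star _⟩
  · apply hinj
    rw [map_sum, map_smul, hCe, Finset.sum_congr rfl fun a _ => hCp a, hu, hcard,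
      ← Complex.coe_smul, smul_smul, ← Complex.ofReal_mul, mul_div_cancel₀ _ hN.ne']
  -- The maximum is reached at the normalization of `u a`, whose squared norm is the trace `c`.
  · intro a
    have hua : star (u a) ⬝ᵥ u a = (c : ℂ) := by
      rw [dotProduct_comm, ← trace_vecMulVec, ← hCp, htr _ (hp a)]
    have hne : u a ≠ 0 := by
      intro h
      rw [h, dotProduct_zero] at hua
      exact hc.ne (by exact_mod_cast hua)
    obtain ⟨r, v, hv, hr⟩ := exists_eq_smul_unitSphere hne
    refine ⟨v, ?_⟩
    have hr2 : r ^ 2 = c := by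
      rw [hua] at hr
      exact_mod_cast hr.symm
    change quadForm v.1.ofLp (C (p a)) = Fintype.card ι * quadForm v.1.ofLp (C e)
    rw [hqe, hCp, quadForm_vecMulVec]
    rw [hv, dotProduct_smul, v.star_dotProduct_self, smul_eq_mul, mul_one, Complex.normSq_ofReal,
      ← sq, hr2]
  · intro y hy hle
    obtain ⟨hyA, hyP⟩ := (hB y).1 hy
    apply hinj
    rw [hCe]
    refine eq_smul_one_of_vecMulVec_le hyP hc (htr y hyA) hcard hu fun a v => ?_
    rw [← hCp, ← hcard]
    exact hle a v

theorem quantumStates_boundariness_max {d : ℕ} (hd : 1 ≤ d) :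
    IsGreatest (boundariness (quantumStates d) '' quantumStates d) (1 / (d : ℝ)) ∧
      {ρ ∈ quantumStates d | boundariness (quantumStates d) ρ = 1 / (d : ℝ)} =
        {completelyMixedState d} := by
  have : Nonempty (Fin d) := ⟨⟨0, hd⟩⟩
  have hd0 : (d : ℂ) ≠ 0 := by exact_mod_cast (Nat.one_le_iff_ne_zero.1 hd)
  let A : AffineSubspace ℝ (Op d) :=
    { carrier := {M | M.IsHermitian ∧ M.trace = 1}
      smul_vsub_vadd_mem' := by
        rintro t x y z ⟨hx, hx1⟩ ⟨hy, hy1⟩ ⟨hz, hz1⟩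
        refine ⟨?_, ?_⟩
        · rw [vsub_eq_sub, vadd_eq_add]
          exact ((hx.sub hy).smul (IsSelfAdjoint.all t)).add hz
        · rw [vsub_eq_sub, vadd_eq_add, trace_add, trace_smul, trace_sub, hx1, hy1, hz1]
          simp }
  have hA : ∀ M, M ∈ A ↔ M.IsHermitian ∧ M.trace = 1 := fun M => Iff.rfl
  have hu : ∀ a : Fin d, vecMulVec (Pi.single a (1 : ℂ)) (star (Pi.single a (1 : ℂ))) =
      Matrix.single a a (1 : ℂ) := fun a => by
    rw [← Pi.single_star, star_one, ← single_eq_single_vecMulVec_single]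
  have h := boundariness_posSemidef_max (A := A) (C := LinearMap.id) (B := quantumStates d)
    (c := 1) (u := fun a : Fin d => Pi.single a 1) (e := completelyMixedState d)
    (p := fun a => vecMulVec (Pi.single a 1) (star (Pi.single a 1)))
    continuous_id Function.injective_id ?_ ?_ one_pos ?_ rfl ?_ ?_ ?_ ?_ ?_
  · rwa [Fintype.card_fin] at h
  · intro x
    exact ⟨fun h => ⟨⟨h.1.1, h.2⟩, h.1⟩, fun h => ⟨h.2, h.1.2⟩⟩
  · exact fun x hx => hx.1
  · intro x hx
    rw [Complex.ofReal_one]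
    exact hx.2
  · simp only [hu]
    rw [Complex.ofReal_one, one_smul]
    exact sum_single_one
  · intro a
    refine ⟨(posSemidef_vecMulVec_self_star _).1, ?_⟩
    rw [hu]
    simp
  · exact fun a => rfl
  · refine ⟨?_, ?_⟩
    · rw [completelyMixedState, IsHermitian, conjTranspose_smul, conjTranspose_one]
      simp
    · rw [completelyMixedState, trace_smul, trace_one, Fintype.card_fin, smul_eq_mul,
        inv_mul_cancel₀ hd0]
  · rw [LinearMap.id_apply, completelyMixedState, Fintype.card_fin]
    simp

end PosSemidefSets

/-! ### Observables, with the `n` sharp trivial observables as the points `p`. -/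

section Observables

open Matrix

theorem uniformTrivialObservable_apply (d n : ℕ) (j : Fin n) :
    uniformTrivialObservable d n j = (((n : ℝ)⁻¹ : ℝ) : ℂ) • (1 : Op d) := by
  simp [uniformTrivialObservable]

theorem sum_uniformTrivialObservable {d n : ℕ} (hn : 1 ≤ n) :
    ∑ j, uniformTrivialObservable d n j = 1 := by
  have hn0 : (n : ℂ) ≠ 0 := by exact_mod_cast Nat.one_le_iff_ne_zero.1 hn
  simp only [uniformTrivialObservable]
  rw [Finset.sum_const, Finset.card_univ, Fintype.card_fin, ← Nat.cast_smul_eq_nsmul ℂ,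
    smul_smul, mul_inv_cancel₀ hn0, one_smul]

theorem continuous_quadForm_family {ι m : Type*} [TopologicalSpace ι] [DiscreteTopology ι]
    [Fintype m] :
    Continuous fun z : (ι × UnitSphere m) × (ι → Matrix m m ℂ) =>
      quadForm z.1.2.1.ofLp (z.2 z.1.1) := by
  have heval : Continuous fun w : ι × (ι → Matrix m m ℂ) => w.2 w.1 :=
    continuous_prod_of_discrete_left.2 fun j => continuous_apply j
  have h1 : Continuous fun z : (ι × UnitSphere m) × (ι → Matrix m m ℂ) => z.1.2 := by fun_prop
  have h2 : Continuous fun z : (ι × UnitSphere m) × (ι → Matrix m m ℂ) => (z.1.1, z.2) := by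
    fun_prop
  have h3 : Continuous fun z : (ι × UnitSphere m) × (ι → Matrix m m ℂ) => z.2 z.1.1 :=
    heval.comp h2
  exact h1.quadForm_unitSphere h3

theorem quantumObservables_boundariness_max {d n : ℕ} (hd : 1 ≤ d) (hn : 1 ≤ n) :
    IsGreatest (boundariness (quantumObservables d n) '' quantumObservables d n) (1 / (n : ℝ)) ∧
      {E ∈ quantumObservables d n | boundariness (quantumObservables d n) E = 1 / (n : ℝ)} =
        {uniformTrivialObservable d n} := by
  have : Nonempty (Fin n) := ⟨⟨0, hn⟩⟩
  have hdpos : Nonempty (Fin d) := ⟨⟨0, hd⟩⟩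
  obtain ⟨v₀⟩ : Nonempty (UnitSphere (Fin d)) := by
    obtain ⟨r, v, -, -⟩ := exists_eq_smul_unitSphere (one_ne_zero : (1 : Fin d → ℂ) ≠ 0)
    exact ⟨v⟩
  have hnpos : 0 < (n : ℝ) := by exact_mod_cast hn
  let A : AffineSubspace ℝ (Fin n → Op d) :=
    { carrier := {E | (∀ j, (E j).IsHermitian) ∧ ∑ j, E j = 1}
      smul_vsub_vadd_mem' := by
        rintro t x y z ⟨hx, hx1⟩ ⟨hy, hy1⟩ ⟨hz, hz1⟩
        refine ⟨fun j => ?_, ?_⟩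
        · exact (((hx j).sub (hy j)).smul (IsSelfAdjoint.all t)).add (hz j)
        · rw [vsub_eq_sub, vadd_eq_add]
          simp only [Pi.add_apply, Pi.smul_apply, Pi.sub_apply]
          rw [Finset.sum_add_distrib, ← Finset.smul_sum, Finset.sum_sub_distrib, hx1, hy1, hz1]
          simp }
  let f : Fin n × UnitSphere (Fin d) → (Fin n → Op d) →ₗ[ℝ] ℝ :=
    fun i => (quadForm i.2.1.ofLp).comp (LinearMap.proj i.1)
  have hf : ∀ i E, f i E = quadForm i.2.1.ofLp (E i.1) := fun i E => rfl
  have hunif := uniformTrivialObservable_apply d n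
  have hfe : ∀ i, f i (uniformTrivialObservable d n) = (n : ℝ)⁻¹ := fun i => by
    rw [hf, hunif, i.2.quadForm_smul_one]
  have hone : ∀ v : UnitSphere (Fin d), quadForm v.1.ofLp (1 : Op d) = 1 := fun v => by
    have := v.quadForm_smul_one 1
    rwa [Complex.ofReal_one, one_smul] at this
  have hB : quantumObservables d n = affineCone A f := by
    ext E
    refine ⟨fun h => ⟨⟨fun j => (h.1 j).1.1, h.2⟩, fun i => (h.1 i.1).1.quadForm_nonneg _⟩, ?_⟩
    rintro ⟨⟨h1, h2⟩, h3⟩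
    have hpsd : ∀ j, (E j).PosSemidef := fun j =>
      posSemidef_iff_quadForm_unitSphere.2 ⟨h1 j, fun v => h3 (j, v)⟩
    refine ⟨fun j => ⟨hpsd j, ?_⟩, h2⟩
    -- The upper bound on an effect is automatic: `1 - E j` is the sum of the other effects.
    rw [← h2, ← Finset.add_sum_erase _ _ (Finset.mem_univ j), add_sub_cancel_left]
    exact posSemidef_sum _ fun k _ => hpsd k
  have hnn : (n : ℝ) * (n : ℝ)⁻¹ = 1 := mul_inv_cancel₀ hnpos.ne'
  have h := boundariness_affineCone_max (ι := Fin n) (A := A) (f := f)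
    (B := quantumObservables d n) (e := uniformTrivialObservable d n)
    (p := fun j => Pi.single j (1 : Op d)) ?_ hB ?_ ?_ ?_ ?_ ?_ ?_ ?_
  · rwa [Fintype.card_fin] at h
  · exact continuous_quadForm_family
  · refine ⟨fun j => ?_, ?_⟩
    · rw [hunif, IsHermitian, conjTranspose_smul, conjTranspose_one]
      simp
    · exact sum_uniformTrivialObservable hn
  · intro i
    rw [hfe]
    exact inv_pos.2 hnpos
  · intro E hE i
    rw [hfe, Fintype.card_fin, hnn, hf]
    have := (hE.1 i.1).2.quadForm_nonneg i.2.1.ofLp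
    rw [map_sub, hone] at this
    linarith
  · intro j
    refine ⟨fun k => ?_, ?_⟩
    · by_cases hkj : k = j
      · subst hkj
        simp [PosSemidef.one, PosSemidef.zero]
      · simp [Pi.single_eq_of_ne hkj, PosSemidef.one, PosSemidef.zero]
    · exact Fintype.sum_pi_single' j 1
  · ext1 k
    rw [Finset.sum_apply, Pi.smul_apply, hunif, ← Complex.coe_smul, smul_smul,
      ← Complex.ofReal_mul, Fintype.card_fin, hnn]
    simp
  · intro j
    refine ⟨(j, v₀), ?_⟩
    rw [hfe, Fintype.card_fin, hnn, hf, Pi.single_eq_same, hone]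
  · intro E hE hle
    have hlow : ∀ i, (n : ℝ)⁻¹ ≤ f i E := fun i => by
      have := hle i.1 i
      rw [hf, Pi.single_eq_same, hone, Fintype.card_fin] at this
      rwa [inv_le_iff_one_le_mul₀' hnpos]
    have hsum : ∀ v : UnitSphere (Fin d), ∑ j, f (j, v) E = 1 := fun v => by
      simp only [hf]
      rw [← map_sum, hE.2, hone]
    have hconst : ∑ _j : Fin n, (n : ℝ)⁻¹ = 1 := by
      rw [Finset.sum_const, Finset.card_univ, Fintype.card_fin, nsmul_eq_mul, hnn]
    ext1 j
    rw [← sub_eq_zero]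
    refine IsHermitian.eq_zero_of_quadForm_unitSphere ?_ fun v => ?_
    · refine (hE.1 j).1.1.sub ?_
      rw [hunif, IsHermitian, conjTranspose_smul, conjTranspose_one]
      simp
    · have := (Finset.sum_eq_sum_iff_of_le fun k _ => hlow (k, v)).1
        (hconst.trans (hsum v).symm) j (Finset.mem_univ j)
      have h2 := hfe (j, v)
      rw [hf] at this h2
      rw [map_sub, h2, ← this, sub_self]

end Observables

/-! ### Channels through Choi matrices and Weyl unitaries. -/

section ChoiMatrix

open Matrix

variable {d : ℕ}

/-- The Choi matrix of a map on operators, as a real-linear function of the map. -/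
noncomputable def choiMatrix (d : ℕ) :
    (Op d →L[ℂ] Op d) →ₗ[ℝ] Matrix (Fin d × Fin d) (Fin d × Fin d) ℂ where
  toFun Φ := Matrix.of fun p q => Φ (Matrix.single p.1 q.1 1) p.2 q.2
  map_add' _ _ := rfl
  map_smul' _ _ := rfl

theorem choiMatrix_apply (Φ : Op d →L[ℂ] Op d) (p q : Fin d × Fin d) :
    choiMatrix d Φ p q = Φ (Matrix.single p.1 q.1 1) p.2 q.2 := rfl

theorem continuous_choiMatrix : Continuous (choiMatrix d) := by
  refine continuous_matrix fun p q => ?_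
  have h : Continuous fun Φ : Op d →L[ℂ] Op d => Φ (Matrix.single p.1 q.1 1) :=
    continuous_eval_const _
  exact h.matrix_elem p.2 q.2

theorem apply_eq_sum_choiMatrix (Φ : Op d →L[ℂ] Op d) (X : Op d) (k l : Fin d) :
    Φ X k l = ∑ i, ∑ j, X i j * choiMatrix d Φ (i, k) (j, l) := by
  conv_lhs => rw [matrix_eq_sum_single X]
  simp only [map_sum, Matrix.sum_apply]
  refine Finset.sum_congr rfl fun i _ => Finset.sum_congr rfl fun j _ => ?_
  have h : Matrix.single i j (X i j) = X i j • Matrix.single i j (1 : ℂ) := by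
    rw [smul_single, smul_eq_mul, mul_one]
  rw [h, map_smul, Matrix.smul_apply, smul_eq_mul, choiMatrix_apply]

theorem choiMatrix_injective : Function.Injective (choiMatrix d) := by
  intro Φ Ψ h
  ext X k l
  rw [apply_eq_sum_choiMatrix, apply_eq_sum_choiMatrix, h]

open scoped MatrixOrder in
theorem Matrix.PosSemidef.exists_eq_conjTranspose_mul_self {m : Type*} [Fintype m]
    {M : Matrix m m ℂ} (hM : M.PosSemidef) : ∃ G : Matrix m m ℂ, M = Gᴴ * G := by
  classical
  exact CStarAlgebra.nonneg_iff_eq_star_mul_self.1 hM.nonneg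

/-- The Choi matrix is the ampliation of the rank-one matrix of the unnormalized maximally entangled
vector `w`. -/
theorem posSemidef_choiMatrix_of_ampliation {Φ : Op d →L[ℂ] Op d}
    (h : ∀ X : Matrix (Fin d × Fin d) (Fin d × Fin d) ℂ,
      X.PosSemidef → (ampliation d Φ X).PosSemidef) : (choiMatrix d Φ).PosSemidef := by
  let w : Fin d × Fin d → ℂ := fun p => if p.1 = p.2 then 1 else 0
  have hw := h _ (posSemidef_vecMulVec_self_star w)
  convert hw using 1
  ext p q
  rw [choiMatrix_apply, ampliation, of_apply]
  refine congrArg (fun Y : Op d => Φ Y p.2 q.2) ?_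
  ext i j
  simp [w, vecMulVec_apply, Matrix.single_apply, ite_and]
  split_ifs <;> rfl

theorem posSemidef_ampliation {Φ : Op d →L[ℂ] Op d} (hΦ : (choiMatrix d Φ).PosSemidef) {k : ℕ}
    {X : Matrix (Fin k × Fin d) (Fin k × Fin d) ℂ} (hX : X.PosSemidef) :
    (ampliation k Φ X).PosSemidef := by
  obtain ⟨D, rfl⟩ := hX.exists_eq_conjTranspose_mul_self
  obtain ⟨G, hG⟩ := hΦ.exists_eq_conjTranspose_mul_self
  -- Contracting the factors of `X = Dᴴ D` and of the Choi matrix `Gᴴ G` over the input index yields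
  -- a factor of the ampliation, in the manner of Kraus operators.
  let T : Matrix ((Fin k × Fin d) × (Fin d × Fin d)) (Fin k × Fin d) ℂ :=
    of fun r q => ∑ j, D r.1 (q.1, j) * G r.2 (j, q.2)
  have hT : ampliation k Φ (Dᴴ * D) = Tᴴ * T := by
    ext p q
    rw [ampliation, of_apply, apply_eq_sum_choiMatrix, hG]
    simp only [mul_apply, of_apply, conjTranspose_apply, T, star_sum, star_mul',
      Finset.sum_mul_sum]
    rw [Fintype.sum_prod_type]
    calc _ = ∑ i, ∑ j, ∑ x, ∑ y, star (D x (p.1, i)) * star (G y (i, p.2)) *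
          (D x (q.1, j) * G y (j, q.2)) := by
          refine Finset.sum_congr rfl fun i _ => Finset.sum_congr rfl fun j _ =>
            Finset.sum_congr rfl fun x _ => Finset.sum_congr rfl fun y _ => ?_
          ring
      _ = ∑ i, ∑ x, ∑ y, ∑ j, star (D x (p.1, i)) * star (G y (i, p.2)) *
          (D x (q.1, j) * G y (j, q.2)) := by
          refine Finset.sum_congr rfl fun i _ => ?_
          rw [Finset.sum_comm]
          exact Finset.sum_congr rfl fun x _ => Finset.sum_comm
      _ = _ := by
          rw [Finset.sum_comm]
          exact Finset.sum_congr rfl fun x _ => Finset.sum_comm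
  rw [hT]
  exact posSemidef_conjTranspose_mul_self T

theorem mem_quantumChannels_iff {Φ : Op d →L[ℂ] Op d} :
    Φ ∈ quantumChannels d ↔
      (choiMatrix d Φ).PosSemidef ∧ ∀ X : Op d, (Φ X).trace = X.trace :=
  ⟨fun h => ⟨posSemidef_choiMatrix_of_ampliation (h.1 d), h.2⟩,
    fun h => ⟨fun _ _ hX => posSemidef_ampliation h.1 hX, h.2⟩⟩

theorem trace_choiMatrix {Φ : Op d →L[ℂ] Op d} (h : ∀ X : Op d, (Φ X).trace = X.trace) :
    (choiMatrix d Φ).trace = ((d : ℝ) : ℂ) := by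
  have h1 : (choiMatrix d Φ).trace = ∑ i, (Φ (Matrix.single i i 1)).trace := by
    simp only [trace, diag_apply, Fintype.sum_prod_type, choiMatrix_apply]
  rw [h1]
  simp [h]

theorem choiMatrix_completelyDepolarizingChannel :
    choiMatrix d (completelyDepolarizingChannel d) =
      ((d : ℂ)⁻¹) • (1 : Matrix (Fin d × Fin d) (Fin d × Fin d) ℂ) := by
  ext ⟨i, k⟩ ⟨j, l⟩
  rw [choiMatrix_apply]
  by_cases hij : i = j <;> by_cases hkl : k = l <;>
    simp [completelyDepolarizingChannel, completelyMixedState, hij, hkl, one_apply,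
      trace_single_eq_of_ne]

/-- Conjugation `X ↦ U X Uᴴ` by a matrix. -/
noncomputable def conjugationMap (U : Op d) : Op d →L[ℂ] Op d :=
  LinearMap.toContinuousLinearMap
    ((LinearMap.mulRight ℂ Uᴴ).comp (LinearMap.mulLeft ℂ U))

theorem conjugationMap_apply (U X : Op d) : conjugationMap U X = U * X * Uᴴ := rfl

theorem choiMatrix_conjugationMap (U : Op d) :
    choiMatrix d (conjugationMap U) =
      vecMulVec (fun p => U p.2 p.1) (star fun p => U p.2 p.1) := by
  ext ⟨i, k⟩ ⟨j, l⟩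
  rw [choiMatrix_apply, conjugationMap_apply, single_eq_single_vecMulVec_single, mul_vecMulVec,
    vecMulVec_mul, vecMulVec_apply, vecMulVec_apply]
  simp

theorem trace_conjugationMap {U : Op d} (hU : Uᴴ * U = 1) (X : Op d) :
    (conjugationMap U X).trace = X.trace := by
  rw [conjugationMap_apply, trace_mul_cycle, hU, one_mul]

/-- The shift-and-clock (Weyl) unitary with shift `a.1` and phase exponent `a.2`. -/
noncomputable def weylMatrix (d : ℕ) [NeZero d] (a : Fin d × Fin d) : Op d :=
  of fun k i => if k = i + a.1 then
    (Complex.exp (2 * Real.pi * Complex.I / d) ^ (i : ℕ)) ^ (a.2 : ℕ) else 0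

theorem star_rootOfUnity_mul_self [NeZero d] :
    star (Complex.exp (2 * Real.pi * Complex.I / d)) * Complex.exp (2 * Real.pi * Complex.I / d)
      = 1 := by
  have h := (Complex.isPrimitiveRoot_exp d (NeZero.ne d)).norm'_eq_one (NeZero.ne d)
  have h2 := Complex.normSq_eq_conj_mul_self
    (z := Complex.exp (2 * Real.pi * Complex.I / d))
  rw [Complex.normSq_eq_norm_sq, h] at h2
  simpa using h2.symm

theorem weylMatrix_conjTranspose_mul_self [NeZero d] (a : Fin d × Fin d) :
    (weylMatrix d a)ᴴ * weylMatrix d a = 1 := by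
  ext i j
  simp only [mul_apply, conjTranspose_apply, weylMatrix, of_apply]
  rw [Finset.sum_eq_single (i + a.1)]
  · by_cases hij : i = j
    · subst hij
      simp only [if_true, one_apply_eq, star_pow]
      rw [← mul_pow, ← mul_pow, star_rootOfUnity_mul_self, one_pow, one_pow]
    · simp [hij, one_apply_ne]
  · intro k _ hk
    simp [hk]
  · simp

/-- A geometric sum with ratio `z = ζ ^ (i - j)`, where `z ^ d = 1`, and `z = 1` only for `i = j`.
-/
theorem sum_pow_mul_star_pow_rootOfUnity [NeZero d] (i j : Fin d) :
    ∑ b : Fin d, (Complex.exp (2 * Real.pi * Complex.I / d) ^ (i : ℕ)) ^ (b : ℕ) *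
      star ((Complex.exp (2 * Real.pi * Complex.I / d) ^ (j : ℕ)) ^ (b : ℕ)) =
      if i = j then (d : ℂ) else 0 := by
  set ζ := Complex.exp (2 * Real.pi * Complex.I / d) with hζ
  have hprim : IsPrimitiveRoot ζ d := Complex.isPrimitiveRoot_exp d (NeZero.ne d)
  have hstar : star ζ * ζ = 1 := star_rootOfUnity_mul_self
  set z : ℂ := ζ ^ (i : ℕ) * star ζ ^ (j : ℕ) with hz
  have hsum : ∑ b : Fin d, (ζ ^ (i : ℕ)) ^ (b : ℕ) * star ((ζ ^ (j : ℕ)) ^ (b : ℕ)) =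
      ∑ b ∈ Finset.range d, z ^ b := by
    rw [← Fin.sum_univ_eq_sum_range]
    refine Finset.sum_congr rfl fun b _ => ?_
    rw [hz, mul_pow, star_pow, star_pow]
  have hzd : z ^ d = 1 := by
    rw [hz, mul_pow, ← pow_mul, ← pow_mul, mul_comm (i : ℕ), mul_comm (j : ℕ), pow_mul, pow_mul,
      ← star_pow, hprim.pow_eq_one]
    simp
  have hzj : z * ζ ^ (j : ℕ) = ζ ^ (i : ℕ) := by
    rw [hz, mul_assoc, ← mul_pow, hstar, one_pow, mul_one]
  rw [hsum]
  split_ifs with hij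
  · have hz1 : z = 1 := by
      rw [hz, hij, ← mul_pow, mul_comm, hstar, one_pow]
    simp [hz1]
  · have hz1 : z ≠ 1 := by
      intro h
      rw [h, one_mul] at hzj
      exact hij (Fin.ext (hprim.pow_inj j.2 i.2 hzj).symm)
    rw [geom_sum_eq hz1, hzd, sub_self, zero_div]

/-- The sum over phases forces `i = j`; then only the shift `k - i` (modulo `d`) survives, and it
forces `k = l`. -/
theorem sum_vecMulVec_weylMatrix [NeZero d] :
    ∑ a, vecMulVec (fun p : Fin d × Fin d => weylMatrix d a p.2 p.1)
      (star fun p => weylMatrix d a p.2 p.1) =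
      (d : ℂ) • (1 : Matrix (Fin d × Fin d) (Fin d × Fin d) ℂ) := by
  ext ⟨i, k⟩ ⟨j, l⟩
  rw [Matrix.sum_apply, Fintype.sum_prod_type, Matrix.smul_apply, smul_eq_mul]
  simp only [vecMulVec_apply, Pi.star_apply, weylMatrix, of_apply]
  have h1 : ∀ a : Fin d, ∑ b : Fin d, (if k = i + a then
        (Complex.exp (2 * Real.pi * Complex.I / d) ^ (i : ℕ)) ^ (b : ℕ) else 0) *
      star (if l = j + a then
        (Complex.exp (2 * Real.pi * Complex.I / d) ^ (j : ℕ)) ^ (b : ℕ) else 0) =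
      if k = i + a ∧ l = j + a ∧ i = j then (d : ℂ) else 0 := fun a => by
    by_cases hk : k = i + a
    · by_cases hl : l = j + a
      · simp only [if_pos hk, if_pos hl, sum_pow_mul_star_pow_rootOfUnity]
        simp [hk, hl]
      · simp [hl]
    · simp [hk]
  rw [Finset.sum_congr rfl fun a _ => h1 a]
  by_cases hij : i = j
  · subst hij
    rw [Finset.sum_eq_single (k - i)]
    · by_cases hkl : k = l
      · subst hkl
        simp
      · have : (i, k) ≠ (i, l) := fun h => hkl (Prod.ext_iff.1 h).2
        rw [one_apply_ne this]
        simp [Ne.symm hkl]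
    · intro a _ ha
      rw [if_neg]
      rintro ⟨rfl, -⟩
      exact ha (by simp)
    · simp
  · have : (i, k) ≠ (j, l) := fun h => hij (Prod.ext_iff.1 h).1
    rw [one_apply_ne this]
    simp [hij]

theorem quantumChannels_boundariness_max (hd : 1 ≤ d) :
    IsGreatest (boundariness (quantumChannels d) '' quantumChannels d) (1 / (d : ℝ) ^ 2) ∧
      {Φ ∈ quantumChannels d | boundariness (quantumChannels d) Φ = 1 / (d : ℝ) ^ 2} =
        {completelyDepolarizingChannel d} := by
  have : NeZero d := ⟨Nat.one_le_iff_ne_zero.1 hd⟩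
  have hd0 : (d : ℂ) ≠ 0 := by exact_mod_cast NeZero.ne d
  have hdR : (0 : ℝ) < d := by exact_mod_cast hd
  have hsmul : ContinuousSMul ℝ (Op d →L[ℂ] Op d) := by
    refine ⟨?_⟩
    have h : Continuous fun z : ℝ × (Op d →L[ℂ] Op d) => (z.1 : ℂ) • z.2 :=
      (Complex.continuous_ofReal.comp continuous_fst).smul continuous_snd
    exact h
  let A : AffineSubspace ℝ (Op d →L[ℂ] Op d) :=
    { carrier := {Φ | (choiMatrix d Φ).IsHermitian ∧ ∀ X : Op d, (Φ X).trace = X.trace}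
      smul_vsub_vadd_mem' := by
        rintro t x y z ⟨hx, hx1⟩ ⟨hy, hy1⟩ ⟨hz, hz1⟩
        refine ⟨?_, fun X => ?_⟩
        · rw [vsub_eq_sub, vadd_eq_add, map_add, map_smul, map_sub]
          exact ((hx.sub hy).smul (IsSelfAdjoint.all t)).add hz
        · have h : (t • (x - y) + z) X = t • (x X - y X) + z X := rfl
          rw [vsub_eq_sub, vadd_eq_add, h, trace_add, trace_smul, trace_sub, hx1, hy1, hz1]
          simp }
  have hcard : (Fintype.card (Fin d × Fin d) : ℝ) = (d : ℝ) ^ 2 := by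
    rw [Fintype.card_prod, Fintype.card_fin]
    push_cast
    ring
  -- Here `c = d` is the trace of the Choi matrix and `N = d ^ 2`, so the center has Choi matrix `c
  -- / N = 1 / d` times the identity.
  have h := boundariness_posSemidef_max (A := A) (B := quantumChannels d) (c := (d : ℝ))
    (u := fun (a : Fin d × Fin d) p => weylMatrix d a p.2 p.1)
    (e := completelyDepolarizingChannel d) (p := fun a => conjugationMap (weylMatrix d a))
    continuous_choiMatrix choiMatrix_injective ?_ ?_ hdR ?_ rfl ?_ ?_ ?_ ?_ ?_
  · rwa [hcard] at h
  · intro Φ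
    rw [mem_quantumChannels_iff]
    exact ⟨fun h => ⟨⟨h.1.1, h.2⟩, h.1⟩, fun h => ⟨h.2, h.1.2⟩⟩
  · exact fun x hx => hx.1
  · exact fun Φ hΦ => trace_choiMatrix hΦ.2
  · exact sum_vecMulVec_weylMatrix
  · intro a
    refine ⟨?_, trace_conjugationMap (weylMatrix_conjTranspose_mul_self a)⟩
    rw [choiMatrix_conjugationMap]
    exact (posSemidef_vecMulVec_self_star _).1
  · exact fun a => choiMatrix_conjugationMap _
  · refine ⟨?_, fun X => ?_⟩
    · rw [choiMatrix_completelyDepolarizingChannel, IsHermitian, conjTranspose_smul,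
        conjTranspose_one]
      simp
    · have h : completelyDepolarizingChannel d X = X.trace • completelyMixedState d := rfl
      rw [h, completelyMixedState, trace_smul, trace_smul, trace_one, Fintype.card_fin]
      simp [hd0]
  · rw [choiMatrix_completelyDepolarizingChannel, hcard]
    congr 1
    push_cast
    field_simp

end ChoiMatrix

theorem mainTheorem4 (d n : ℕ) (hd : 1 ≤ d) (hn : 1 ≤ n) :
    (IsGreatest (boundariness (quantumStates d) '' quantumStates d) (1 / (d : ℝ)) ∧
      {ρ ∈ quantumStates d | boundariness (quantumStates d) ρ = 1 / (d : ℝ)} =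
        {completelyMixedState d}) ∧
    (IsGreatest (boundariness (quantumObservables d n) '' quantumObservables d n) (1 / (n : ℝ)) ∧
      {E ∈ quantumObservables d n | boundariness (quantumObservables d n) E = 1 / (n : ℝ)} =
        {uniformTrivialObservable d n}) ∧
    (IsGreatest (boundariness (quantumChannels d) '' quantumChannels d) (1 / (d : ℝ) ^ 2) ∧
      {Φ ∈ quantumChannels d | boundariness (quantumChannels d) Φ = 1 / (d : ℝ) ^ 2} =
        {completelyDepolarizingChannel d}) := by
  exact ⟨quantumStates_boundariness_max hd, quantumObservables_boundariness_max hd hn,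
    quantumChannels_boundariness_max hd⟩
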